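/- Let $\mathcal X$ be a standard Borel space with a probability measure $\nu$, and let $\mathcal H$ be a separable reproducing kernel Hilbert space of real functions on $\mathcal X$ whose kernel $K:\mathcal X\times\mathcal X\to\mathbb R$ is measurable and satisfies $\sup_{x\in\mathcal X}K(x,x)\le\kappa^2$ for some $\kappa>0$. For $n\ge 1$ and $\mathbf x=(x_1,\dots,x_n)\in\mathcal X^n$ define the bounded operators on $\mathcal H$ $$\bar B f=\kappa^{-2}\int_{\mathcal X} f(x)\,K(x,\cdot)\,d\nu(x),\qquad \bar B_{\mathbf x} f=\frac{\kappa^{-2}}{n}\sum_{j=1}^n f(x_j)\,K(x_j,\cdot),$$ and for $\lambda\in(0,1]$ the effective dimension and its empirical counterpart $$\mathcal N(\lambda)=\operatorname{tr}\big((\bar B+\lambda)^{-1}\bar B\big),\qquad \mathcal N_{\mathbf x}(\lambda)=\operatorname{tr}\big((\bar B_{\mathbf x}+\lambda)^{-1}\bar B_{\mathbf x}\big).$$ These are well defined: $\bar B+\lambda$ and $\bar B_{\mathbf x}+\lambda$ are boundedly invertible, and the operators under the traces are trace class. Then for every $\eta\in(0,1)$, every integer $n\ge1$ and every $\lambda\in(0,1]$,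 if $\mathbf x=(x_1,\dots,x_n)$ is drawn from $\nu^{\otimes n}$, then with probability at least $1-\eta$ $$|\mathcal N(\lambda)-\mathcal N_{\mathbf x}(\lambda)|\le 2\log(4\eta^{-1})\,\big(1+\sqrt{\mathcal N_{\mathbf x}(\lambda)}\big)\left(\frac{2}{\lambda n}+\sqrt{\frac{\mathcal N(\lambda)}{n\lambda}}\right).$$ -/

import Mathlib

open MeasureTheory

noncomputable section

namespace EffDim

section Operators

variable {H : Type*} [NormedAddCommGroup H] [InnerProductSpace ℝ H]

/-- A bounded operator `T` on a real Hilbert space is trace class when `∑ |⟪u i, T (v i)⟫| < ∞` for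
any two orthonormal families `u`, `v` with the same index set. -/
def IsTraceClass (T : H →L[ℝ] H) : Prop :=
  ∀ (s : Set H) (u v : s → H), Orthonormal ℝ u → Orthonormal ℝ v →
    Summable fun i => |inner ℝ (u i) (T (v i))|

variable [CompleteSpace H]

variable (H) in
/-- The index set of a fixed Hilbert basis of `H`. -/
def basisIndex : Set H := (exists_hilbertBasis ℝ H).choose

variable (H) in
/-- A fixed Hilbert basis of `H`. -/
def basis : HilbertBasis (basisIndex H) ℝ H := (exists_hilbertBasis ℝ H).choose_spec.choose

/-- The trace `∑ ⟪e i, T (e i)⟫` over a Hilbert basis `e`. For trace class `T` it converges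
absolutely, and its value does not depend on the basis. -/
def opTrace (T : H →L[ℝ] H) : ℝ := ∑' i, inner ℝ (basis H i) (T (basis H i))

/-- The operator `(T + l)⁻¹ T`. -/
def resolventOp (T : H →L[ℝ] H) (l : ℝ) : H →L[ℝ] H := Ring.inverse (T + l • 1) * T

/-- `tr ((T + l)⁻¹ T)`. -/
def effDim (T : H →L[ℝ] H) (l : ℝ) : ℝ := opTrace (resolventOp T l)

/-- The quantity `tr ((T + l)⁻¹ T)` makes sense: `T + l` has a bounded inverse, and `(T + l)⁻¹ T`
is trace class. -/
def EffDimDefined (T : H →L[ℝ] H) (l : ℝ) : Prop :=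
  IsUnit (T + l • 1) ∧ IsTraceClass (resolventOp T l)

end Operators

section Kernel

variable {X : Type*} (H : Type*) [NormedAddCommGroup H] [InnerProductSpace ℝ H] [CompleteSpace H]
  [RKHS ℝ H X ℝ]

/-- The scalar reproducing kernel `K (x, y)` of a real-valued RKHS. -/
def scalarKernel (x y : X) : ℝ := RKHS.kernel H x y 1

/-- The kernel section `K (x, ·)` as an element of the RKHS. -/
def feature (x : X) : H := RKHS.kerFun H x 1

variable {H}

theorem inner_feature (x : X) (f : H) : inner ℝ (feature H x) f = f x := by
  simp [feature]

theorem feature_apply (x y : X) : feature H x y = scalarKernel H y x := by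
  simp [feature, scalarKernel, RKHS.kerFun_apply]

variable (H)

/-- The rank one operator `f ↦ f(x) K (x, ·)`. -/
def pointOp (x : X) : H →L[ℝ] H := InnerProductSpace.rankOne ℝ (feature H x) (feature H x)

variable {H}

theorem pointOp_apply (x : X) (f : H) : pointOp H x f = f x • feature H x := by
  simp [pointOp, inner_feature]

variable (H)

/-- The kernel integral operator `B f = ∫ f(x) K (x, ·) dν(x)`, as a Bochner integral of
operators; see `kernelOp_apply`. -/
def kernelOp [MeasurableSpace X] (ν : Measure X) : H →L[ℝ] H := ∫ x, pointOp H x ∂ν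

/-- The empirical operator `B_x f = (1/n) ∑ f(x_j) K (x_j, ·)`. -/
def empKernelOp {n : ℕ} (x : Fin n → X) : H →L[ℝ] H := (n : ℝ)⁻¹ • ∑ j, pointOp H (x j)

variable {H}

theorem empKernelOp_apply {n : ℕ} (x : Fin n → X) (f : H) :
    empKernelOp H x f = (n : ℝ)⁻¹ • ∑ j, f (x j) • feature H (x j) := by
  simp [empKernelOp, pointOp_apply]

variable (H)

/-- The normalised operator `κ⁻² B`. -/
def kernelOpBar [MeasurableSpace X] (ν : Measure X) (κ : ℝ) : H →L[ℝ] H :=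
  (κ ^ 2)⁻¹ • kernelOp H ν

/-- The normalised empirical operator `κ⁻² B_x`. -/
def empKernelOpBar {n : ℕ} (x : Fin n → X) (κ : ℝ) : H →L[ℝ] H := (κ ^ 2)⁻¹ • empKernelOp H x

/-- The effective dimension `N(l)`. -/
def effectiveDim [MeasurableSpace X] (ν : Measure X) (κ l : ℝ) : ℝ := effDim (kernelOpBar H ν κ) l

/-- The empirical effective dimension `N_x(l)`. -/
def empEffectiveDim {n : ℕ} (x : Fin n → X) (κ l : ℝ) : ℝ := effDim (empKernelOpBar H x κ) l

variable {H}

theorem norm_feature_sq (x : X) : ‖feature H x‖ ^ 2 = scalarKernel H x x := by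
  rw [← real_inner_self_eq_norm_sq, inner_feature, feature_apply]

variable [MeasurableSpace X]

theorem measurable_coe (hK : Measurable fun p : X × X => scalarKernel H p.1 p.2) (f : H) :
    Measurable (fun x => f x) := by
  have hd := RKHS.kerFun_dense (𝕜 := ℝ) (X := X) (V := ℝ) H
  have hf : f ∈ closure ((Submodule.span ℝ {RKHS.kerFun H x v | (x : X) (v : ℝ)} : Submodule ℝ H) :
      Set H) := by
    have : f ∈ (Submodule.span ℝ {RKHS.kerFun H x v | (x : X) (v : ℝ)}).topologicalClosure := by
      rw [hd]; trivial
    exact this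
  obtain ⟨u, hu, hlim⟩ := mem_closure_iff_seq_limit.1 hf
  have hspan : ∀ g ∈ Submodule.span ℝ {RKHS.kerFun H x v | (x : X) (v : ℝ)},
      Measurable fun x => g x := by
    intro g hg
    induction hg using Submodule.span_induction with
    | mem g hg =>
      obtain ⟨y, v, rfl⟩ := hg
      have : ∀ x, (RKHS.kerFun H y v) x = v * scalarKernel H x y := by
        intro x
        rw [RKHS.kerFun_apply, scalarKernel, ← smul_eq_mul, ← map_smul]
        simp
      simp_rw [this]
      exact (hK.comp measurable_prodMk_right).const_mul v
    | zero => simp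
    | add a b _ _ ha hb =>
      rw [RKHS.coe_add]
      exact ha.add hb
    | smul c a _ ha =>
      rw [RKHS.coe_smul]
      exact ha.const_mul c
  refine measurable_of_tendsto_metrizable (fun n => hspan _ (hu n)) ?_
  rw [tendsto_pi_nhds]
  intro x
  exact ((RKHS.continuous_eval (𝕜 := ℝ) (V := ℝ) x).tendsto f).comp hlim

theorem stronglyMeasurable_feature [TopologicalSpace.SeparableSpace H]
    (hK : Measurable fun p : X × X => scalarKernel H p.1 p.2) :
    StronglyMeasurable fun x : X => feature H x := by
  have hc : Countable (basisIndex H) := by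
    have ho := (basis H).orthonormal
    have hd : Pairwise (Function.onFun Disjoint fun i => Metric.ball (basis H i) (1 / 2)) := by
      intro i j hij
      refine Metric.ball_disjoint_ball ?_
      have h1 : ‖basis H i - basis H j‖ ^ 2 = 2 := by
        rw [norm_sub_sq_real, ho.1 i, ho.1 j, ho.2 hij]; norm_num
      rw [dist_eq_norm]
      nlinarith [norm_nonneg (basis H i - basis H j)]
    exact hd.countable_of_isOpen_disjoint (fun _ => Metric.isOpen_ball)
      fun _ => Metric.nonempty_ball.2 (by norm_num)
  have h : ∀ x : X, HasSum (fun i => (basis H i) x • basis H i) (feature H x) := by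
    intro x
    have := (basis H).hasSum_repr (feature H x)
    refine this.congr_fun ?_
    intro i
    rw [HilbertBasis.repr_apply_apply, real_inner_comm, inner_feature]
  refine stronglyMeasurable_of_tendsto (Filter.atTop : Filter (Finset (basisIndex H)))
    (f := fun s x => ∑ i ∈ s, (basis H i) x • basis H i) ?_ ?_
  · intro s
    refine Finset.stronglyMeasurable_fun_sum s fun i _ => ?_
    exact (measurable_coe hK (basis H i)).stronglyMeasurable.smul_const _
  · rw [tendsto_pi_nhds]
    exact fun x => h x

theorem integrable_pointOp [TopologicalSpace.SeparableSpace H] (ν : Measure X)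
    [IsFiniteMeasure ν] (hK : Measurable fun p : X × X => scalarKernel H p.1 p.2)
    (k : ℝ) (hk : ∀ x : X, scalarKernel H x x ≤ k ^ 2) :
    Integrable (fun x : X => pointOp H x) ν := by
  have hc : Continuous fun f : H => InnerProductSpace.rankOne ℝ f f :=
    (InnerProductSpace.rankOne ℝ).continuous.clm_apply continuous_id
  refine Integrable.of_bound (hc.comp_stronglyMeasurable
    (stronglyMeasurable_feature hK)).aestronglyMeasurable (k ^ 2) (Filter.Eventually.of_forall ?_)
  intro x
  have : ‖pointOp H x‖ ≤ ‖feature H x‖ ^ 2 := by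
    rw [pointOp, sq, InnerProductSpace.norm_rankOne]
  exact this.trans ((norm_feature_sq x).trans_le (hk x))

theorem kernelOp_apply [TopologicalSpace.SeparableSpace H] (ν : Measure X)
    [IsFiniteMeasure ν] (hK : Measurable fun p : X × X => scalarKernel H p.1 p.2)
    (k : ℝ) (hk : ∀ x : X, scalarKernel H x x ≤ k ^ 2) (f : H) :
    kernelOp H ν f = ∫ x, f x • feature H x ∂ν := by
  rw [kernelOp, ContinuousLinearMap.integral_apply (integrable_pointOp ν hK k hk)]
  simp_rw [pointOp_apply]

end Kernel

end EffDim

end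

open MeasureTheory

noncomputable section

namespace EffDim

/-! ### A Bernstein inequality in Hilbert space -/

section Bernstein

/-! With `φ x = κ⁻¹ K(x, ·)`, of norm at most `1`, both operators are second moments `∫ φ ⊗ φ`: `B`
under `ν`, `B'` under the empirical measure. Put `R = (B + λ)⁻¹` and `Z = (B' + λ)⁻¹ B'`. The
resolvent identity `resolventOp_sub_resolventOp` reads `R B - Z = R (B - B') (1 - Z)`, so the sample
enters only through `B'` and `Z`. Taking traces (`abs_effDim_covOp_sub_le`), `tr R (B - B')` is the
deviation of an empirical mean of `⟪φ, R φ⟫`, while `tr R (B' - B) Z` is the Hilbert-Schmidt inner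
product of `(B' - B) R` with `Z`. Since `Z² ≤ Z`, the Hilbert-Schmidt norm of `Z` is at most `√(tr
Z) = √N_x`, which produces the factor `1 + √N_x`.

Both deviations concern i.i.d. vectors of norm at most `1/λ` and second moment at most `N/λ`,
because `λ ‖R φ‖² ≤ ⟪φ, R φ⟫ ≤ 1/λ`. The Bernstein bound `measureReal_lt_norm_mean_sub_le` controls
each outside an event of probability `η/2`. It rests on Pinelis' device: `cosh ‖S‖` grows in mean by
a factor at most `1 + v` when an independent centred summand of norm at most `1` and variance at
most `v` is added to `S`. -/

/-- `q ↦ cosh (√q)` is convex on `[0, ∞)`. -/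
theorem cosh_le_of_sq_eq {w p q r : ℝ} (hw0 : 0 ≤ w) (hw1 : w ≤ 1)
    (h : r ^ 2 = w * p ^ 2 + (1 - w) * q ^ 2) :
    Real.cosh r ≤ w * Real.cosh p + (1 - w) * Real.cosh q := by
  -- Termwise in the power series: the coefficients are nonnegative and each `q ↦ q ^ k` is convex
  -- on `[0, ∞)`.
  refine hasSum_le (fun k => ?_) (Real.hasSum_cosh r)
    (((Real.hasSum_cosh p).mul_left w).add ((Real.hasSum_cosh q).mul_left (1 - w)))
  have h2 : (r ^ 2) ^ k ≤ w * (p ^ 2) ^ k + (1 - w) * (q ^ 2) ^ k := by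
    rw [h]
    have := (convexOn_pow k).2 (sq_nonneg p) (sq_nonneg q) hw0 (sub_nonneg.2 hw1) (by ring)
    simpa using this
  rw [← pow_mul, ← pow_mul, ← pow_mul] at h2
  calc r ^ (2 * k) / ((2 * k).factorial : ℝ)
      ≤ (w * p ^ (2 * k) + (1 - w) * q ^ (2 * k)) / ((2 * k).factorial : ℝ) := by gcongr
    _ = _ := by ring

theorem integrable_cosh_norm {F β : Type*} [NormedAddCommGroup F] [MeasurableSpace β]
    {μ : Measure β} [IsFiniteMeasure μ] {S : β → F} (hS : StronglyMeasurable S) {C : ℝ} (hC : ∀ x, ‖S x‖ ≤ C) :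
    Integrable (fun x => Real.cosh ‖S x‖) μ := by
  refine Integrable.of_bound (Real.continuous_cosh.comp_stronglyMeasurable
    hS.norm).aestronglyMeasurable (Real.cosh C) (.of_forall fun x => ?_)
  rw [Real.norm_of_nonneg (Real.cosh_pos _).le, Real.cosh_le_cosh, abs_norm]
  exact (hC x).trans (le_abs_self C)

variable {E : Type*} [NormedAddCommGroup E] [InnerProductSpace ℝ E]

/-- A second order bound for `cosh ‖s + x‖` around `s`, with the linear term made explicit. -/
theorem cosh_norm_add_le (s x : E) :
    Real.cosh ‖s + x‖ ≤ Real.cosh ‖s‖ * (Real.exp ‖x‖ - ‖x‖) +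
      Real.sinh ‖s‖ / ‖s‖ * inner ℝ s x := by
  -- `c` is the cosine of the angle between `s` and `x`.
  obtain ⟨c, hc, hi⟩ : ∃ c : ℝ, |c| ≤ 1 ∧ inner ℝ s x = c * (‖s‖ * ‖x‖) := by
    refine ⟨inner ℝ s x / (‖s‖ * ‖x‖), abs_real_inner_div_norm_mul_norm_le_one s x, ?_⟩
    by_cases h : ‖s‖ * ‖x‖ = 0
    · have := abs_real_inner_le_norm s x
      rw [h] at this ⊢
      simpa using this
    · rw [div_mul_cancel₀ _ h]
  have hns := norm_add_sq_real s x
  rw [hi] at hns ⊢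
  have hlin : Real.sinh ‖s‖ / ‖s‖ * (c * (‖s‖ * ‖x‖)) = c * ‖x‖ * Real.sinh ‖s‖ := by
    by_cases h : ‖s‖ = 0
    · simp [h]
    · field_simp
  rw [hlin]
  generalize ‖s + x‖ = r at *
  have ha := norm_nonneg s
  have hb := norm_nonneg x
  generalize ‖s‖ = a at *
  generalize ‖x‖ = b at *
  obtain ⟨hc1, hc2⟩ := abs_le.1 hc
  -- By the law of cosines, `r²` is the average of `(a + b)²` and `(a - b)²` with weights `(1 ± c) /
  -- 2`.
  have h := cosh_le_of_sq_eq (w := (1 + c) / 2) (p := a + b) (q := a - b) (r := r)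
    (by linarith) (by linarith) (by rw [hns]; ring)
  rw [Real.cosh_add, Real.cosh_sub] at h
  have hsb : b ≤ Real.sinh b := Real.self_le_sinh_iff.2 hb
  have hsa : Real.sinh a ≤ Real.cosh a := (Real.sinh_lt_cosh a).le
  have hsa0 : 0 ≤ Real.sinh a := Real.sinh_nonneg_iff.2 ha
  rw [← Real.cosh_add_sinh b]
  -- Splitting `sinh b = b + (sinh b - b)` keeps the term linear in `c b` exact; it must survive so
  -- that it can integrate to zero.
  have h1 : c * (Real.sinh a * (Real.sinh b - b)) ≤ Real.sinh a * (Real.sinh b - b) :=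
    mul_le_of_le_one_left (mul_nonneg hsa0 (sub_nonneg.2 hsb)) hc2
  have h2 : Real.sinh a * (Real.sinh b - b) ≤ Real.cosh a * (Real.sinh b - b) :=
    mul_le_mul_of_nonneg_right hsa (sub_nonneg.2 hsb)
  nlinarith [h, h1, h2]

variable [CompleteSpace E] {α : Type*} [MeasurableSpace α] {ν : Measure α} [IsProbabilityMeasure ν]

/-- Centring kills the linear term of `cosh_norm_add_le`, and `exp b - b ≤ 1 + b²` for `0 ≤ b ≤ 1`.
-/
theorem integral_cosh_norm_add_le {Y : α → E} (hY : StronglyMeasurable Y) (h0 : ∫ x, Y x ∂ν = 0)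
    (h1 : ∀ x, ‖Y x‖ ≤ 1) {v : ℝ} (hv : ∫ x, ‖Y x‖ ^ 2 ∂ν ≤ v) (s : E) :
    ∫ x, Real.cosh ‖s + Y x‖ ∂ν ≤ Real.cosh ‖s‖ * (1 + v) := by
  have hYi : Integrable Y ν := Integrable.of_bound hY.aestronglyMeasurable 1 (.of_forall h1)
  have hY2 : Integrable (fun x => ‖Y x‖ ^ 2) ν := by
    refine Integrable.of_bound (hY.norm.pow 2).aestronglyMeasurable 1 (.of_forall fun x => ?_)
    rw [Real.norm_of_nonneg (by positivity)]
    exact pow_le_one₀ (norm_nonneg _) (h1 x)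
  have hle : ∀ x, Real.cosh ‖s + Y x‖ ≤ Real.cosh ‖s‖ * (1 + ‖Y x‖ ^ 2) +
      Real.sinh ‖s‖ / ‖s‖ * inner ℝ s (Y x) := by
    intro x
    refine (cosh_norm_add_le s (Y x)).trans ?_
    have := (abs_le.1 (Real.abs_exp_sub_one_sub_id_le (x := ‖Y x‖)
      (by rw [abs_of_nonneg (norm_nonneg _)]; exact h1 x))).2
    gcongr
    linarith
  have hi1 : Integrable (fun x => Real.cosh ‖s‖ * (1 + ‖Y x‖ ^ 2)) ν :=
    ((integrable_const 1).add hY2).const_mul _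
  have hi2 : Integrable (fun x => Real.sinh ‖s‖ / ‖s‖ * inner ℝ s (Y x)) ν :=
    (hYi.const_inner s).const_mul _
  calc ∫ x, Real.cosh ‖s + Y x‖ ∂ν
      ≤ ∫ x, (Real.cosh ‖s‖ * (1 + ‖Y x‖ ^ 2) + Real.sinh ‖s‖ / ‖s‖ * inner ℝ s (Y x)) ∂ν :=
        integral_mono_of_nonneg (.of_forall fun x => (Real.cosh_pos _).le) (hi1.add hi2)
          (.of_forall hle)
    _ = Real.cosh ‖s‖ * (1 + ∫ x, ‖Y x‖ ^ 2 ∂ν) := by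
        rw [integral_add hi1 hi2, integral_const_mul, integral_const_mul, integral_inner hYi, h0,
          integral_add (integrable_const _) hY2]
        simp
    _ ≤ _ := by
        have := Real.cosh_pos ‖s‖
        gcongr

/-- Induction on `n`: by Fubini one coordinate is integrated with the others frozen, at the cost of
a factor `1 + v`. -/
theorem integral_cosh_norm_sum_le {Y : α → E} (hY : StronglyMeasurable Y) (h0 : ∫ x, Y x ∂ν = 0)
    (h1 : ∀ x, ‖Y x‖ ≤ 1) {v : ℝ} (hv : ∫ x, ‖Y x‖ ^ 2 ∂ν ≤ v) (n : ℕ) :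
    ∫ x, Real.cosh ‖∑ j, Y (x j)‖ ∂(Measure.pi fun _ : Fin n => ν) ≤ (1 + v) ^ n := by
  have hv0 : 0 ≤ v := (integral_nonneg fun x => by positivity).trans hv
  induction n with
  | zero => simp
  | succ n ih =>
    have hsm : StronglyMeasurable fun y : Fin n → α => ∑ j, Y (y j) :=
      Finset.stronglyMeasurable_fun_sum _ fun j _ => hY.comp_measurable (measurable_pi_apply j)
    have hb : ∀ y : Fin n → α, ‖∑ j, Y (y j)‖ ≤ n := fun y => by
      simpa using norm_sum_le_of_le Finset.univ fun j _ => h1 (y j)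
    have hmp := (measurePreserving_piFinSuccAbove (fun _ : Fin (n + 1) => ν) 0).symm
    rw [← hmp.integral_comp']
    have hint : Integrable (fun p : α × (Fin n → α) => Real.cosh ‖∑ j, Y (p.2 j) + Y p.1‖)
        (ν.prod (Measure.pi fun _ : Fin n => ν)) :=
      integrable_cosh_norm ((hsm.comp_measurable measurable_snd).add
        (hY.comp_measurable measurable_fst)) (C := n + 1)
        fun p => (norm_add_le _ _).trans (add_le_add (hb _) (h1 _))
    calc _ = ∫ p, Real.cosh ‖∑ j, Y (p.2 j) + Y p.1‖ ∂ν.prod (Measure.pi fun _ : Fin n => ν) := by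
          refine integral_congr_ae (.of_forall fun p => ?_)
          simp [MeasurableEquiv.piFinSuccAbove, Fin.sum_univ_succ, add_comm]
      _ = ∫ y, ∫ x, Real.cosh ‖∑ j, Y (y j) + Y x‖ ∂ν ∂(Measure.pi fun _ : Fin n => ν) :=
          integral_prod_symm _ hint
      _ ≤ ∫ y, Real.cosh ‖∑ j, Y (y j)‖ * (1 + v) ∂(Measure.pi fun _ : Fin n => ν) :=
          integral_mono_of_nonneg
            (.of_forall fun y => integral_nonneg fun x => (Real.cosh_pos _).le)
            ((integrable_cosh_norm hsm hb).mul_const _)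
            (.of_forall fun y => integral_cosh_norm_add_le hY h0 h1 hv _)
      _ ≤ (1 + v) ^ (n + 1) := by
          rw [integral_mul_const, pow_succ]
          gcongr

/-- Tail bound for the norm of a sum of independent centred random vectors of variance at most `v`,
bounded by `1`. -/
theorem measureReal_lt_norm_sum_le {Y : α → E} (hY : StronglyMeasurable Y)
    (h0 : ∫ x, Y x ∂ν = 0) (h1 : ∀ x, ‖Y x‖ ≤ 1) {v : ℝ} (hv : ∫ x, ‖Y x‖ ^ 2 ∂ν ≤ v) (n : ℕ)
    (r : ℝ) :
    (Measure.pi fun _ : Fin n => ν).real {x | r < ‖∑ j, Y (x j)‖} ≤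
      2 * Real.exp (n * v - r) := by
  have hv0 : 0 ≤ v := (integral_nonneg fun x => by positivity).trans hv
  have hsm : StronglyMeasurable fun y : Fin n → α => ∑ j, Y (y j) :=
    Finset.stronglyMeasurable_fun_sum _ fun j _ => hY.comp_measurable (measurable_pi_apply j)
  have hb : ∀ y : Fin n → α, ‖∑ j, Y (y j)‖ ≤ n := fun y => by
    simpa using norm_sum_le_of_le Finset.univ fun j _ => h1 (y j)
  -- Markov at level `exp r / 2`, since `cosh y ≥ exp y / 2`; hence the factor `2` in the bound.
  have hmarkov := mul_meas_ge_le_integral_of_nonneg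
    (μ := Measure.pi fun _ : Fin n => ν) (f := fun x => Real.cosh ‖∑ j, Y (x j)‖)
    (.of_forall fun x => (Real.cosh_pos _).le) (integrable_cosh_norm hsm hb) (Real.exp r / 2)
  have hsub : {x : Fin n → α | r < ‖∑ j, Y (x j)‖} ⊆
      {x | Real.exp r / 2 ≤ Real.cosh ‖∑ j, Y (x j)‖} := by
    intro x hx
    have h2 : Real.exp r ≤ Real.exp ‖∑ j, Y (x j)‖ := Real.exp_le_exp.2 (le_of_lt hx)
    have h3 := Real.exp_pos (-‖∑ j, Y (x j)‖)
    simp only [Set.mem_ofPred_eq, Real.cosh_eq]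
    linarith
  have h4 : (1 + v) ^ n ≤ Real.exp (n * v) := by
    rw [Real.exp_nat_mul]
    gcongr
    linarith [Real.add_one_le_exp v]
  have h5 := (hmarkov.trans (integral_cosh_norm_sum_le hY h0 h1 hv n)).trans h4
  calc _ ≤ (Measure.pi fun _ : Fin n => ν).real
        {x | Real.exp r / 2 ≤ Real.cosh ‖∑ j, Y (x j)‖} := measureReal_mono hsub
    _ ≤ _ := by
      rw [Real.exp_sub, mul_div_assoc', le_div_iff₀ (Real.exp_pos r)]
      linarith

/-- A Bernstein inequality for the mean of `n` independent copies of a bounded random vector. -/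
theorem measureReal_lt_norm_mean_sub_le {ξ : α → E} (hξ : StronglyMeasurable ξ) {L σ : ℝ}
    (hL : 0 < L) (hσ : 0 ≤ σ) (hb : ∀ x, ‖ξ x‖ ≤ L) (hv : ∫ x, ‖ξ x‖ ^ 2 ∂ν ≤ σ ^ 2)
    {n : ℕ} (hn : 0 < n) {d : ℝ} (hd : 1 ≤ d) :
    (Measure.pi fun _ : Fin n => ν).real
      {x | 2 * d * (2 * L / n + σ / √n) < ‖(n : ℝ)⁻¹ • ∑ j, ξ (x j) - ∫ x, ξ x ∂ν‖} ≤
      2 * Real.exp (-d) := by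
  have hn' : (0 : ℝ) < n := by exact_mod_cast hn
  have hsn : 0 < √(n : ℝ) := Real.sqrt_pos.2 hn'
  have hss : √(n : ℝ) ^ 2 = n := Real.sq_sqrt hn'.le
  have hi : Integrable ξ ν := Integrable.of_bound hξ.aestronglyMeasurable L (.of_forall hb)
  have hi2 : Integrable (fun x => ‖ξ x‖ ^ 2) ν := by
    refine Integrable.of_bound (hξ.norm.pow 2).aestronglyMeasurable (L ^ 2)
      (.of_forall fun x => ?_)
    rw [Real.norm_of_nonneg (by positivity)]
    gcongr
    exact hb x
  set m := ∫ x, ξ x ∂ν with hm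
  have hmb : ‖m‖ ≤ L := by
    simpa using norm_integral_le_of_norm_le_const (μ := ν) (.of_forall hb)
  have hA : 0 < 2 * L + σ * √n := by positivity
  -- This scale gives both `t ‖ξ - m‖ ≤ 2 t L ≤ 1` and `n t² σ² ≤ 1`.
  set t : ℝ := (2 * L + σ * √n)⁻¹ with ht
  have ht0 : 0 < t := inv_pos.2 hA
  have htA : t * (2 * L + σ * √n) = 1 := inv_mul_cancel₀ hA.ne'
  have htail := measureReal_lt_norm_sum_le (ν := ν) (Y := fun x => t • (ξ x - m))
    (v := t ^ 2 * σ ^ 2) ((hξ.sub stronglyMeasurable_const).const_smul t) ?_ ?_ ?_ n (2 * d)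
  · refine (measureReal_mono fun x hx => ?_).trans (htail.trans ?_)
    · simp only [Set.mem_ofPred_eq] at hx ⊢
      have e1 : ∑ j, t • (ξ (x j) - m) = (t * n) • ((n : ℝ)⁻¹ • ∑ j, ξ (x j) - m) := by
        rw [← Finset.smul_sum, Finset.sum_sub_distrib, smul_sub, smul_sub, smul_smul, mul_assoc,
          mul_inv_cancel₀ hn'.ne']
        simp [mul_smul, Nat.cast_smul_eq_nsmul]
      rw [e1, norm_smul, Real.norm_of_nonneg (by positivity)]
      have e2 : 2 * d = t * n * (2 * d * (2 * L / n + σ / √n)) := by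
        have : (n : ℝ) * (2 * L / n + σ / √n) = 2 * L + σ * √n := by
          field_simp
          linear_combination (-σ) * hss
        calc 2 * d = 2 * d * (t * (2 * L + σ * √n)) := by rw [htA, mul_one]
          _ = _ := by rw [← this]; ring
      rw [e2]
      exact mul_lt_mul_of_pos_left hx (by positivity)
    -- The exponent is at most `1 - 2 d`, hence at most `-d` because `1 ≤ d`.
    · have : n * (t ^ 2 * σ ^ 2) ≤ 1 := by
        calc n * (t ^ 2 * σ ^ 2) = (t * (σ * √n)) ^ 2 := by rw [mul_pow, mul_pow, hss]; ring
          _ ≤ 1 := by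
            refine pow_le_one₀ (by positivity) ?_
            rw [← htA]
            gcongr
            linarith
      gcongr
      linarith
  · rw [integral_smul, integral_sub hi (integrable_const m)]
    simp [hm]
  · intro x
    rw [norm_smul, Real.norm_of_nonneg ht0.le, ← htA]
    gcongr
    have := norm_sub_le (ξ x) m
    have := hb x
    have : 0 ≤ σ * √n := by positivity
    linarith
  -- The variance is the second moment minus `‖m‖²`.
  · have e : ∀ x, ‖t • (ξ x - m)‖ ^ 2 = t ^ 2 * (‖ξ x‖ ^ 2 - 2 * inner ℝ m (ξ x) + ‖m‖ ^ 2) := by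
      intro x
      rw [norm_smul, mul_pow, Real.norm_of_nonneg ht0.le, norm_sub_sq_real, real_inner_comm]
    simp_rw [e]
    have hi3 : Integrable (fun x => 2 * inner ℝ m (ξ x)) ν := (hi.const_inner m).const_mul 2
    have hi4 : Integrable (fun x => ‖ξ x‖ ^ 2 - 2 * inner ℝ m (ξ x)) ν := hi2.sub hi3
    rw [integral_const_mul, integral_add hi4 (integrable_const _), integral_sub hi2 hi3,
      integral_const_mul, integral_inner hi, ← hm, real_inner_self_eq_norm_sq]
    gcongr
    simp only [integral_const, probReal_univ, smul_eq_mul]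
    nlinarith [sq_nonneg ‖m‖]

end Bernstein

/-! ### Resolvents of positive operators -/

section Resolvent

variable {H : Type*} [NormedAddCommGroup H] [InnerProductSpace ℝ H] [CompleteSpace H]
  {T : H →L[ℝ] H} {l : ℝ}

theorem isUnit_add_smul_one (hT : T.IsPositive) (hl : 0 < l) : IsUnit (T + l • 1) := by
  refine ContinuousLinearMap.isUnit_of_forall_le_norm_inner_map _ (c := ⟨l, hl.le⟩) hl fun x => ?_
  have h := hT.inner_nonneg_left x
  refine le_trans ?_ (le_abs_self _)
  simp only [add_apply, smul_apply, one_apply_eq_self, inner_add_left, real_inner_smul_left,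
    real_inner_self_eq_norm_sq]
  change ‖x‖ ^ 2 * l ≤ _
  linarith

theorem map_inverse_add (hT : T.IsPositive) (hl : 0 < l) (f : H) :
    T (Ring.inverse (T + l • 1) f) + l • Ring.inverse (T + l • 1) f = f := by
  have h := Ring.mul_inverse_cancel _ (isUnit_add_smul_one hT hl)
  simpa using DFunLike.congr_fun h f

theorem inverse_map_add (hT : T.IsPositive) (hl : 0 < l) (f : H) :
    Ring.inverse (T + l • 1) (T f) + l • Ring.inverse (T + l • 1) f = f := by
  have h := Ring.inverse_mul_cancel _ (isUnit_add_smul_one hT hl)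
  simpa using DFunLike.congr_fun h f

theorem inner_inverse_comm (hT : T.IsPositive) (hl : 0 < l) (f g : H) :
    inner ℝ (Ring.inverse (T + l • 1) f) g = inner ℝ f (Ring.inverse (T + l • 1) g) := by
  conv_lhs => rw [← map_inverse_add hT hl g]
  conv_rhs => rw [← map_inverse_add hT hl f]
  rw [inner_add_left, inner_add_right, real_inner_smul_left, real_inner_smul_right]
  congr 1
  exact (hT.isSymmetric _ _).symm

/-- Pair `(T + l) g = f` with `g = (T + l)⁻¹ f` and drop `⟪T g, g⟫ ≥ 0`. This later supplies the
variance bound. -/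
theorem mul_norm_inverse_sq_le (hT : T.IsPositive) (hl : 0 < l) (f : H) :
    l * ‖Ring.inverse (T + l • 1) f‖ ^ 2 ≤ inner ℝ f (Ring.inverse (T + l • 1) f) := by
  have h := congrArg (inner ℝ · (Ring.inverse (T + l • 1) f)) (map_inverse_add hT hl f)
  simp only [inner_add_left, real_inner_smul_left, real_inner_self_eq_norm_sq] at h
  linarith [hT.inner_nonneg_left (Ring.inverse (T + l • 1) f)]

theorem norm_inverse_le (hT : T.IsPositive) (hl : 0 < l) (f : H) :
    ‖Ring.inverse (T + l • 1) f‖ ≤ l⁻¹ * ‖f‖ := by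
  have h1 := mul_norm_inverse_sq_le hT hl f
  have h2 := real_inner_le_norm f (Ring.inverse (T + l • 1) f)
  rw [inv_mul_eq_div, le_div_iff₀' hl]
  rcases (norm_nonneg (Ring.inverse (T + l • 1) f)).eq_or_lt with h | h
  · rw [← h]; simp
  · refine le_of_mul_le_mul_right ?_ h
    linarith

theorem inner_inverse_nonneg (hT : T.IsPositive) (hl : 0 < l) (f : H) :
    0 ≤ inner ℝ f (Ring.inverse (T + l • 1) f) :=
  le_trans (by positivity) (mul_norm_inverse_sq_le hT hl f)

theorem inner_inverse_le (hT : T.IsPositive) (hl : 0 < l) (f : H) :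
    inner ℝ f (Ring.inverse (T + l • 1) f) ≤ l⁻¹ * ‖f‖ ^ 2 := by
  have h1 := norm_inverse_le hT hl f
  have h2 := real_inner_le_norm f (Ring.inverse (T + l • 1) f)
  nlinarith [mul_le_mul_of_nonneg_left h1 (norm_nonneg f)]

/-- This is `Z² ≤ Z` for `Z = (T + l)⁻¹ T`: with `g = (T + l)⁻¹ f` one has `f - Z f = l g` and `Z f
= T g`, so the gap is `l ⟪g, T g⟫ ≥ 0`. -/
theorem norm_resolventOp_sq_le (hT : T.IsPositive) (hl : 0 < l) (f : H) :
    ‖resolventOp T l f‖ ^ 2 ≤ inner ℝ f (resolventOp T l f) := by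
  have e1 : resolventOp T l f = Ring.inverse (T + l • 1) (T f) := rfl
  have h1 := inverse_map_add hT hl f
  have h2 := map_inverse_add hT hl f
  rw [← e1] at h1
  have e2 : resolventOp T l f = T (Ring.inverse (T + l • 1) f) := by
    rw [← add_left_inj (l • Ring.inverse (T + l • 1) f), h1, h2]
  have h3 : inner ℝ f (resolventOp T l f) - ‖resolventOp T l f‖ ^ 2 =
      l * inner ℝ (Ring.inverse (T + l • 1) f) (T (Ring.inverse (T + l • 1) f)) := by
    rw [← real_inner_self_eq_norm_sq, ← inner_sub_left, ← real_inner_smul_left, ← e2]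
    congr 1
    rw [sub_eq_iff_eq_add, add_comm, h1]
  have h4 := mul_nonneg hl.le (hT.inner_nonneg_right (Ring.inverse (T + l • 1) f))
  linarith

/-- The difference of two operators `(S + l)⁻¹ S` and `(T + l)⁻¹ T`. -/
theorem resolventOp_sub_resolventOp {S : H →L[ℝ] H} (hS : S.IsPositive) (hT : T.IsPositive)
    (hl : 0 < l) :
    resolventOp S l - resolventOp T l = Ring.inverse (S + l • 1) * S -
      Ring.inverse (S + l • 1) * T -
      (Ring.inverse (S + l • 1) * S - Ring.inverse (S + l • 1) * T) * resolventOp T l := by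
  have h1 := Ring.inverse_mul_cancel _ (isUnit_add_smul_one hS hl)
  have h2 := Ring.mul_inverse_cancel _ (isUnit_add_smul_one hT hl)
  have h3 : Ring.inverse (S + l • 1) * S = 1 - l • Ring.inverse (S + l • 1) := by
    rw [mul_add, mul_smul_comm, mul_one] at h1
    exact eq_sub_of_add_eq h1
  have h4 : T * Ring.inverse (T + l • 1) = 1 - l • Ring.inverse (T + l • 1) := by
    rw [add_mul, smul_mul_assoc, one_mul] at h2
    exact eq_sub_of_add_eq h2
  rw [resolventOp, resolventOp, h3, sub_mul, sub_mul, one_mul, smul_mul_assoc, mul_assoc _ T,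
    ← mul_assoc T, h4, sub_mul, mul_sub, one_mul, smul_mul_assoc, mul_smul_comm]
  abel

end Resolvent

/-! ### Covariance operators and their traces -/

section Covariance

variable {H : Type*} [NormedAddCommGroup H] [InnerProductSpace ℝ H] {Ω : Type*} [MeasurableSpace Ω]

/-- The uncentred covariance operator `∫ φ ⊗ φ` of a random vector `φ`. -/
def covOp (φ : Ω → H) (μ : Measure Ω) : H →L[ℝ] H :=
  ∫ x, InnerProductSpace.rankOne ℝ (φ x) (φ x) ∂μ

variable {φ : Ω → H}

theorem integrable_rankOne (hφ : StronglyMeasurable φ) (hb : ∀ x, ‖φ x‖ ≤ 1)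
    (μ : Measure Ω) [IsProbabilityMeasure μ] :
    Integrable (fun x => InnerProductSpace.rankOne ℝ (φ x) (φ x)) μ := by
  have hc : Continuous fun f : H => InnerProductSpace.rankOne ℝ f f :=
    (InnerProductSpace.rankOne ℝ).continuous.clm_apply continuous_id
  refine Integrable.of_bound (hc.comp_stronglyMeasurable hφ).aestronglyMeasurable 1
    (.of_forall fun x => ?_)
  rw [InnerProductSpace.norm_rankOne]
  exact mul_le_one₀ (hb x) (norm_nonneg _) (hb x)

theorem norm_map_le_norm {Ω : Type*} {φ : Ω → H} (hb : ∀ x, ‖φ x‖ ≤ 1) (A : H →L[ℝ] H)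
    (x : Ω) : ‖A (φ x)‖ ≤ ‖A‖ :=
  A.le_of_opNorm_le_of_le le_rfl (hb x) |>.trans_eq (mul_one _)

theorem integrable_inner_sq (μ : Measure Ω) [IsProbabilityMeasure μ]
    {ψ : Ω → H} (hψ : StronglyMeasurable ψ) {C : ℝ}
    (hC : ∀ x, ‖ψ x‖ ≤ C) (f : H) : Integrable (fun x => inner ℝ f (ψ x) ^ 2) μ := by
  refine Integrable.of_bound ((stronglyMeasurable_const.inner hψ).pow 2).aestronglyMeasurable
    ((‖f‖ * C) ^ 2) (.of_forall fun x => ?_)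
  rw [norm_pow]
  gcongr
  exact (norm_inner_le_norm _ _).trans (by gcongr; exact hC x)

/-- Bessel's inequality at each point, then integration. -/
theorem summable_integral_inner_sq (μ : Measure Ω) [IsProbabilityMeasure μ]
    {ψ : Ω → H} (hψ : StronglyMeasurable ψ) {C : ℝ}
    (hC : ∀ x, ‖ψ x‖ ≤ C) {ι : Type*} {u : ι → H} (hu : Orthonormal ℝ u) :
    Summable fun i => ∫ x, inner ℝ (u i) (ψ x) ^ 2 ∂μ := by
  refine summable_of_sum_le (c := C ^ 2) (fun i => integral_nonneg fun x => sq_nonneg _) fun s => ?_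
  rw [← integral_finsetSum _ fun i _ => integrable_inner_sq μ hψ hC (u i)]
  calc _ ≤ ∫ _, C ^ 2 ∂μ := by
        refine integral_mono_of_nonneg
          (.of_forall fun x => Finset.sum_nonneg fun i _ => sq_nonneg _) (integrable_const _)
          (.of_forall fun x => ?_)
        have h := hu.sum_inner_products_le (x := ψ x) (s := s)
        simp only [Real.norm_eq_abs, sq_abs] at h
        exact h.trans (pow_le_pow_left₀ (norm_nonneg _) (hC x) 2)
    _ = C ^ 2 := by simp

/-- Basis vectors are `√2` apart, so balls of radius `1/2` around them are disjoint. Countability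
permits exchanging the basis sum with the integral. -/
theorem _root_.HilbertBasis.countable_of_separableSpace {ι : Type*}
    [TopologicalSpace.SeparableSpace H] (b : HilbertBasis ι ℝ H) : Countable ι := by
  have ho := b.orthonormal
  have hd : Pairwise (Function.onFun Disjoint fun i => Metric.ball (b i) (1 / 2)) := by
    intro i j hij
    refine Metric.ball_disjoint_ball ?_
    have h1 : ‖b i - b j‖ ^ 2 = 2 := by
      rw [norm_sub_sq_real, ho.1 i, ho.1 j, ho.2 hij]; norm_num
    rw [dist_eq_norm]
    nlinarith [norm_nonneg (b i - b j)]
  exact hd.countable_of_isOpen_disjoint (fun _ => Metric.isOpen_ball)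
    fun _ => Metric.nonempty_ball.2 (by norm_num)

theorem covOp_apply (hφ : StronglyMeasurable φ) (hb : ∀ x, ‖φ x‖ ≤ 1)
    (μ : Measure Ω) [IsProbabilityMeasure μ]
    (f : H) : covOp φ μ f = ∫ x, inner ℝ (φ x) f • φ x ∂μ := by
  rw [covOp, ContinuousLinearMap.integral_apply (integrable_rankOne hφ hb μ)]
  simp

theorem integrable_inner_smul (hφ : StronglyMeasurable φ) (hb : ∀ x, ‖φ x‖ ≤ 1)
    (μ : Measure Ω) [IsProbabilityMeasure μ]
    (f : H) : Integrable (fun x => inner ℝ (φ x) f • φ x) μ := by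
  simpa using (integrable_rankOne hφ hb μ).apply_continuousLinearMap f

/-- `|a b| ≤ a² + b²` reduces this to two Bessel sums. Distinct `u`, `v` serve the trace class
property; `u = v` a basis serves the trace formula. -/
theorem summable_integral_abs (hφ : StronglyMeasurable φ) (hb : ∀ x, ‖φ x‖ ≤ 1)
    (μ : Measure Ω) [IsProbabilityMeasure μ]
    (A : H →L[ℝ] H) {ι : Type*} {u v : ι → H} (hu : Orthonormal ℝ u)
    (hv : Orthonormal ℝ v) :
    Summable fun i => ∫ x, |inner ℝ (u i) (A (φ x)) * inner ℝ (v i) (φ x)| ∂μ := by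
  have hA := A.continuous.comp_stronglyMeasurable hφ
  have hAb := norm_map_le_norm hb A
  refine Summable.of_nonneg_of_le (fun i => integral_nonneg fun x => abs_nonneg _) (fun i => ?_)
    ((summable_integral_inner_sq μ hA hAb hu).add (summable_integral_inner_sq μ hφ hb hv))
  have h1 := integrable_inner_sq μ hA hAb (u i)
  have h2 := integrable_inner_sq μ hφ hb (v i)
  rw [← integral_add h1 h2]
  refine integral_mono_of_nonneg (.of_forall fun x => abs_nonneg _) (h1.add h2)
    (.of_forall fun x => ?_)
  simp only
  rw [abs_le]
  constructor <;> nlinarith [sq_nonneg (inner ℝ (u i) (A (φ x)) + inner ℝ (v i) (φ x)),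
    sq_nonneg (inner ℝ (u i) (A (φ x)) - inner ℝ (v i) (φ x)),
    sq_nonneg (inner ℝ (u i) (A (φ x))), sq_nonneg (inner ℝ (v i) (φ x))]

variable [CompleteSpace H]

theorem inner_covOp (hφ : StronglyMeasurable φ) (hb : ∀ x, ‖φ x‖ ≤ 1)
    (μ : Measure Ω) [IsProbabilityMeasure μ]
    (f g : H) :
    inner ℝ f (covOp φ μ g) = ∫ x, inner ℝ f (φ x) * inner ℝ (φ x) g ∂μ := by
  rw [covOp_apply hφ hb, ← integral_inner (integrable_inner_smul hφ hb μ g)]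
  simp_rw [real_inner_smul_right, mul_comm]

theorem covOp_isPositive (hφ : StronglyMeasurable φ) (hb : ∀ x, ‖φ x‖ ≤ 1)
    (μ : Measure Ω) [IsProbabilityMeasure μ]
    : (covOp φ μ).IsPositive := by
  refine (ContinuousLinearMap.isPositive_def').2 ⟨?_, fun f => ?_⟩
  · rw [ContinuousLinearMap.isSelfAdjoint_iff_isSymmetric]
    intro f g
    change inner ℝ (covOp φ μ f) g = inner ℝ f (covOp φ μ g)
    rw [real_inner_comm, inner_covOp hφ hb, inner_covOp hφ hb]
    refine integral_congr_ae (.of_forall fun x => ?_)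
    simp only [real_inner_comm, mul_comm]
  · change 0 ≤ inner ℝ (covOp φ μ f) f
    rw [real_inner_comm, inner_covOp hφ hb]
    refine integral_nonneg fun x => ?_
    rw [real_inner_comm]
    exact mul_self_nonneg _

theorem inner_mul_covOp (hφ : StronglyMeasurable φ) (hb : ∀ x, ‖φ x‖ ≤ 1)
    (μ : Measure Ω) [IsProbabilityMeasure μ]
    (A : H →L[ℝ] H) (f g : H) :
    inner ℝ f ((A * covOp φ μ) g) = ∫ x, inner ℝ f (A (φ x)) * inner ℝ g (φ x) ∂μ := by
  change inner ℝ f (A (covOp φ μ g)) = _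
  rw [← ContinuousLinearMap.adjoint_inner_left, inner_covOp hφ hb]
  refine integral_congr_ae (.of_forall fun x => ?_)
  simp only [ContinuousLinearMap.adjoint_inner_left, real_inner_comm g]

theorem isTraceClass_mul_covOp (hφ : StronglyMeasurable φ) (hb : ∀ x, ‖φ x‖ ≤ 1)
    (μ : Measure Ω) [IsProbabilityMeasure μ]
    (A : H →L[ℝ] H) : IsTraceClass (A * covOp φ μ) := by
  intro s u v hu hv
  refine Summable.of_nonneg_of_le (fun i => abs_nonneg _) (fun i => ?_)
    (summable_integral_abs hφ hb μ A hu hv)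
  rw [inner_mul_covOp hφ hb]
  exact abs_integral_le_integral_abs

theorem effDimDefined_covOp (hφ : StronglyMeasurable φ) (hb : ∀ x, ‖φ x‖ ≤ 1)
    (μ : Measure Ω) [IsProbabilityMeasure μ]
    {l : ℝ} (hl : 0 < l) : EffDimDefined (covOp φ μ) l :=
  ⟨isUnit_add_smul_one (covOp_isPositive hφ hb μ) hl, isTraceClass_mul_covOp hφ hb μ _⟩

/-- The trace of `A B` for a covariance operator `B = ∫ φ ⊗ φ`. -/
theorem hasSum_inner_mul_covOp (hφ : StronglyMeasurable φ) (hb : ∀ x, ‖φ x‖ ≤ 1)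
    (μ : Measure Ω) [IsProbabilityMeasure μ]
    [TopologicalSpace.SeparableSpace H] {ι : Type*}
    (b : HilbertBasis ι ℝ H) (A : H →L[ℝ] H) :
    HasSum (fun i => inner ℝ (b i) ((A * covOp φ μ) (b i))) (∫ x, inner ℝ (φ x) (A (φ x)) ∂μ) := by
  have := b.countable_of_separableSpace
  simp_rw [inner_mul_covOp hφ hb]
  have hA := A.continuous.comp_stronglyMeasurable hφ
  have hint : ∀ i, Integrable (fun x => inner ℝ (b i) (A (φ x)) * inner ℝ (b i) (φ x)) μ := by
    intro i
    refine Integrable.of_bound ((stronglyMeasurable_const.inner hA).mul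
      (stronglyMeasurable_const.inner hφ)).aestronglyMeasurable (‖A‖ * 1) (.of_forall fun x => ?_)
    have h1 : ‖inner ℝ (b i) (A (φ x))‖ ≤ ‖A‖ := by
      refine (norm_inner_le_norm _ _).trans ?_
      rw [b.orthonormal.1 i, one_mul]
      exact norm_map_le_norm hb A x
    have h2 : ‖inner ℝ (b i) (φ x)‖ ≤ 1 := by
      refine (norm_inner_le_norm _ _).trans ?_
      rw [b.orthonormal.1 i, one_mul]
      exact hb x
    rw [norm_mul]
    gcongr
  have h := hasSum_integral_of_summable_integral_norm hint
    (summable_integral_abs hφ hb μ A b.orthonormal b.orthonormal)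
  -- Parseval at each point identifies the integrand with the exchanged sum.
  have e : ∀ x, inner ℝ (φ x) (A (φ x)) =
      ∑' i, inner ℝ (b i) (A (φ x)) * inner ℝ (b i) (φ x) := fun x => by
    rw [← b.tsum_inner_mul_inner (φ x) (A (φ x))]
    exact tsum_congr fun i => by rw [mul_comm, real_inner_comm (φ x)]
  simp_rw [e]
  exact h

theorem effDim_covOp (hφ : StronglyMeasurable φ) (hb : ∀ x, ‖φ x‖ ≤ 1)
    (μ : Measure Ω) [IsProbabilityMeasure μ]
    [TopologicalSpace.SeparableSpace H] (l : ℝ) :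
    effDim (covOp φ μ) l =
      ∫ x, inner ℝ (φ x) (Ring.inverse (covOp φ μ + l • 1) (φ x)) ∂μ :=
  (hasSum_inner_mul_covOp hφ hb μ (basis H) _).tsum_eq

end Covariance

/-! ### Hilbert-Schmidt operators as square-summable families -/

section HilbertSchmidt

theorem memℓp_two_of_summable {ι F : Type*} [NormedAddCommGroup F] {f : ι → F}
    (hf : Summable fun i => ‖f i‖ ^ 2) : Memℓp f 2 :=
  memℓp_gen (by simpa using hf)

variable {H : Type*} [NormedAddCommGroup H] [InnerProductSpace ℝ H] {ι : Type*}

theorem norm_sq_lp_two_eq_tsum (f : lp (fun _ : ι => H) 2) : ‖f‖ ^ 2 = ∑' i, ‖f i‖ ^ 2 := by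
  rw [← real_inner_self_eq_norm_sq, lp.inner_eq_tsum]
  simp_rw [real_inner_self_eq_norm_sq]

theorem hasSum_norm_inner_smul_sq (b : HilbertBasis ι ℝ H) (u v : H) :
    HasSum (fun i => ‖inner ℝ u (b i) • v‖ ^ 2) ((‖u‖ * ‖v‖) ^ 2) := by
  have h := (b.hasSum_inner_mul_inner u u).mul_right (‖v‖ ^ 2)
  rw [real_inner_self_eq_norm_sq, ← mul_pow] at h
  refine h.congr_fun fun i => ?_
  rw [norm_smul, mul_pow, Real.norm_eq_abs, sq_abs, real_inner_comm u, sq (inner ℝ _ _)]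

/-- The rank one operator `f ↦ ⟪u, f⟫ v`, as a Hilbert-Schmidt operator: the family of its values
on an orthonormal basis. -/
def rankOneHS (b : HilbertBasis ι ℝ H) : H →L[ℝ] H →L[ℝ] lp (fun _ : ι => H) 2 :=
  LinearMap.mkContinuous₂
    (LinearMap.mk₂ ℝ
      (fun u v => (⟨fun i => inner ℝ u (b i) • v,
        memℓp_two_of_summable (hasSum_norm_inner_smul_sq b u v).summable⟩ :
          lp (fun _ : ι => H) 2))
      (fun u u' v => by
        ext i; exact (congrArg (· • v) (inner_add_left u u' (b i))).trans (add_smul _ _ v))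
      (fun c u v => by ext i; simp [real_inner_smul_left, mul_smul])
      (fun u v v' => by ext i; exact smul_add _ v v')
      (fun c u v => by ext i; simp [smul_comm c]))
    1 fun u v => by
      refine le_of_sq_le_sq ?_ (by positivity)
      rw [norm_sq_lp_two_eq_tsum, one_mul]
      exact (hasSum_norm_inner_smul_sq b u v).tsum_eq.le

theorem rankOneHS_apply (b : HilbertBasis ι ℝ H) (u v : H) (i : ι) :
    rankOneHS b u v i = inner ℝ u (b i) • v := rfl

theorem norm_rankOneHS (b : HilbertBasis ι ℝ H) (u v : H) : ‖rankOneHS b u v‖ = ‖u‖ * ‖v‖ := by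
  rw [← sq_eq_sq₀ (norm_nonneg _) (by positivity), norm_sq_lp_two_eq_tsum]
  exact (hasSum_norm_inner_smul_sq b u v).tsum_eq

variable {Ω : Type*} {φ : Ω → H}

theorem norm_rankOneHS_le (b : HilbertBasis ι ℝ H) (hb : ∀ x, ‖φ x‖ ≤ 1) (A : H →L[ℝ] H) (x : Ω) :
    ‖rankOneHS b (A (φ x)) (φ x)‖ ≤ ‖A (φ x)‖ := by
  rw [norm_rankOneHS]
  exact mul_le_of_le_one_right (norm_nonneg _) (hb x)

variable [MeasurableSpace Ω]

theorem stronglyMeasurable_rankOneHS (b : HilbertBasis ι ℝ H) (hφ : StronglyMeasurable φ)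
    (A : H →L[ℝ] H) : StronglyMeasurable fun x => rankOneHS b (A (φ x)) (φ x) := by
  have hc : Continuous fun f : H => rankOneHS b (A f) f :=
    ((rankOneHS b).continuous.comp A.continuous).clm_apply continuous_id
  exact hc.comp_stronglyMeasurable hφ

variable [CompleteSpace H]

/-- Evaluation at `i` is continuous and linear, so it commutes with the integral, and symmetry moves
`A` onto `b i`. Thus the integral represents `covOp φ μ * A`. -/
theorem integral_rankOneHS_apply (b : HilbertBasis ι ℝ H) (hφ : StronglyMeasurable φ)
    (hb : ∀ x, ‖φ x‖ ≤ 1) (μ : Measure Ω) [IsProbabilityMeasure μ] (A : H →L[ℝ] H)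
    (hA : ∀ f g, inner ℝ (A f) g = inner ℝ f (A g)) (i : ι) :
    (∫ x, rankOneHS b (A (φ x)) (φ x) ∂μ) i = covOp φ μ (A (b i)) := by
  have hi : Integrable (fun x => rankOneHS b (A (φ x)) (φ x)) μ :=
    Integrable.of_bound (stronglyMeasurable_rankOneHS b hφ A).aestronglyMeasurable ‖A‖
      (.of_forall fun x => (norm_rankOneHS_le b hb A x).trans (norm_map_le_norm hb A x))
  change lp.evalCLM ℝ (fun _ : ι => H) 2 i _ = _
  rw [← ContinuousLinearMap.integral_comp_comm _ hi, covOp_apply hφ hb]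
  refine integral_congr_ae (.of_forall fun x => ?_)
  change rankOneHS b (A (φ x)) (φ x) i = _
  rw [rankOneHS_apply, hA]

/-- Comparison of the effective dimensions of one random vector under two probability measures. -/
theorem abs_effDim_covOp_sub_le [TopologicalSpace.SeparableSpace H] (hφ : StronglyMeasurable φ)
    (hb : ∀ x, ‖φ x‖ ≤ 1) (μ μ' : Measure Ω) [IsProbabilityMeasure μ] [IsProbabilityMeasure μ']
    {l : ℝ} (hl : 0 < l) {R : H →L[ℝ] H} (hR : R = Ring.inverse (covOp φ μ + l • 1)) :
    |effDim (covOp φ μ) l - effDim (covOp φ μ') l| ≤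
      ‖∫ x, inner ℝ (φ x) (R (φ x)) ∂μ' - ∫ x, inner ℝ (φ x) (R (φ x)) ∂μ‖ +
      √(effDim (covOp φ μ') l) * ‖∫ x, rankOneHS (basis H) (R (φ x)) (φ x) ∂μ' -
        ∫ x, rankOneHS (basis H) (R (φ x)) (φ x) ∂μ‖ := by
  have hB := covOp_isPositive hφ hb μ
  have hB' := covOp_isPositive hφ hb μ'
  have hsub := resolventOp_sub_resolventOp hB hB' hl
  rw [← hR] at hsub
  have hRs : ∀ f g, inner ℝ (R f) g = inner ℝ f (R g) := by
    rw [hR]; exact inner_inverse_comm hB hl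
  set b := basis H
  set Z := resolventOp (covOp φ μ') l with hZ
  have hN := hasSum_inner_mul_covOp hφ hb μ b R
  have hN' := hasSum_inner_mul_covOp hφ hb μ' b (Ring.inverse (covOp φ μ' + l • 1))
  rw [← effDim_covOp hφ hb μ' l] at hN'
  have hM := hasSum_inner_mul_covOp hφ hb μ' b R
  have hle : ∀ i, ‖Z (b i)‖ ^ 2 ≤ inner ℝ (b i) (Z (b i)) := fun i =>
    norm_resolventOp_sq_le hB' hl (b i)
  have hZs : Summable fun i => ‖Z (b i)‖ ^ 2 :=
    Summable.of_nonneg_of_le (fun i => sq_nonneg _) hle hN'.summable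
  -- `Z` as a Hilbert-Schmidt operator; its squared norm is at most its trace because `Z² ≤ Z`.
  let z : lp (fun _ : basisIndex H => H) 2 := ⟨fun i => Z (b i), memℓp_two_of_summable hZs⟩
  have hz : ‖z‖ ≤ √(effDim (covOp φ μ') l) := by
    refine Real.le_sqrt_of_sq_le ?_
    rw [norm_sq_lp_two_eq_tsum, ← hN'.tsum_eq]
    exact hZs.tsum_le_tsum hle hN'.summable
  set D := ∫ x, rankOneHS b (R (φ x)) (φ x) ∂μ' - ∫ x, rankOneHS b (R (φ x)) (φ x) ∂μ with hD
  have hDi : ∀ i, D i = covOp φ μ' (R (b i)) - covOp φ μ (R (b i)) := by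
    intro i
    rw [hD, lp.coeFn_sub, Pi.sub_apply, integral_rankOneHS_apply b hφ hb μ R hRs,
      integral_rankOneHS_apply b hφ hb μ' R hRs]
  have hDz := lp.hasSum_inner (𝕜 := ℝ) D z
  -- The trace of the resolvent identity: the terms without `Z` give the two scalar integrals, and
  -- those with `Z` give `⟪D, z⟫` once `R` and the covariances are moved across the inner product.
  have hsum : HasSum (fun i => inner ℝ (b i) (resolventOp (covOp φ μ) l (b i)) -
      inner ℝ (b i) (Z (b i))) (∫ x, inner ℝ (φ x) (R (φ x)) ∂μ -
        ∫ x, inner ℝ (φ x) (R (φ x)) ∂μ' + inner ℝ D z) := by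
    refine ((hN.sub hM).add hDz).congr_fun fun i => ?_
    have h1 := DFunLike.congr_fun hsub (b i)
    have h2 : inner ℝ (D i) (z i) = inner ℝ (b i) ((R * covOp φ μ') (Z (b i))) -
        inner ℝ (b i) ((R * covOp φ μ) (Z (b i))) := by
      rw [hDi, inner_sub_left]
      change inner ℝ _ (Z (b i)) - inner ℝ _ (Z (b i)) =
        inner ℝ (b i) (R (covOp φ μ' (Z (b i)))) - inner ℝ (b i) (R (covOp φ μ (Z (b i))))
      rw [← hRs, ← hRs]
      congr 1
      · exact hB'.isSymmetric _ _
      · exact hB.isSymmetric _ _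
    rw [h2, ← inner_sub_right, ← inner_sub_right, ← inner_sub_right, ← inner_add_right]
    congr 1
    calc _ = (resolventOp (covOp φ μ) l - Z) (b i) := rfl
      _ = _ := by
        rw [h1]
        simp only [sub_apply, mul_apply_eq_comp]
        abel
  have hN1 := hasSum_inner_mul_covOp hφ hb μ b (Ring.inverse (covOp φ μ + l • 1))
  rw [← effDim_covOp hφ hb μ l] at hN1
  rw [(hN1.sub hN').unique hsum]
  refine (abs_add_le _ _).trans (add_le_add ?_ ?_)
  · rw [Real.norm_eq_abs, abs_sub_comm]
  · refine (abs_real_inner_le_norm D z).trans ?_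
    rw [mul_comm]
    gcongr

end HilbertSchmidt

/-! ### Empirical measures and the concentration bound -/

section Sample

variable {X : Type*} [MeasurableSpace X]

/-- The empirical measure of a sample. -/
def empMeasure {n : ℕ} (x : Fin n → X) : Measure X :=
  (n : ENNReal)⁻¹ • ∑ j, Measure.dirac (x j)

theorem isProbabilityMeasure_empMeasure {n : ℕ} (hn : 0 < n) (x : Fin n → X) :
    IsProbabilityMeasure (empMeasure x) := by
  refine ⟨?_⟩
  simp only [empMeasure, Measure.smul_apply, Measure.coe_finsetSum, Finset.sum_apply,
    measure_univ, Finset.sum_const, Finset.card_univ, Fintype.card_fin, nsmul_eq_mul, mul_one,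
    smul_eq_mul]
  exact ENNReal.inv_mul_cancel (by exact_mod_cast hn.ne') (ENNReal.natCast_ne_top n)

theorem integral_empMeasure {E : Type*} [NormedAddCommGroup E] [NormedSpace ℝ E] [CompleteSpace E]
    {n : ℕ} (x : Fin n → X) {f : X → E} (hf : StronglyMeasurable f) :
    ∫ y, f y ∂(empMeasure x) = (n : ℝ)⁻¹ • ∑ j, f (x j) := by
  rw [empMeasure, integral_smul_measure, integral_finsetSum_measure]
  · simp [integral_dirac' f _ hf]
  · intro j _
    exact ⟨hf.aestronglyMeasurable, by
      rw [hasFiniteIntegral_iff_enorm, lintegral_dirac' _ hf.enorm]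
      exact enorm_lt_top⟩

/-- Subadditivity suffices, so neither event has to be measurable. -/
theorem one_sub_le_measureReal_of_compl_subset {Ω : Type*} [MeasurableSpace Ω] {μ : Measure Ω}
    [IsProbabilityMeasure μ] {s t : Set Ω} {η : ℝ} (hs : μ.real s ≤ η) (hst : sᶜ ⊆ t) :
    1 - η ≤ μ.real t := by
  have h1 : μ.real Set.univ ≤ μ.real (s ∪ t) := measureReal_mono fun x _ => by
    by_cases hx : x ∈ s
    · exact Or.inl hx
    · exact Or.inr (hst hx)
  have h2 := measureReal_union_le (μ := μ) s t
  rw [probReal_univ] at h1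
  linarith

/-- The concentration of the empirical effective dimension, for covariance operators. -/
theorem one_sub_le_measureReal_effDim_covOp {H : Type*} [NormedAddCommGroup H]
    [InnerProductSpace ℝ H] [CompleteSpace H] [TopologicalSpace.SeparableSpace H] {φ : X → H}
    (hφ : StronglyMeasurable φ) (hb : ∀ x, ‖φ x‖ ≤ 1) (ν : Measure X) [IsProbabilityMeasure ν]
    {η : ℝ} (hη0 : 0 < η) (hη1 : η < 1) {n : ℕ} (hn : 0 < n) {l : ℝ} (hl : 0 < l) :
    1 - η ≤ (Measure.pi fun _ : Fin n => ν).real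
      {x | |effDim (covOp φ ν) l - effDim (covOp φ (empMeasure x)) l| ≤
        2 * Real.log (4 / η) * (1 + √(effDim (covOp φ (empMeasure x)) l)) *
          (2 / (l * n) + √(effDim (covOp φ ν) l / (n * l)))} := by
  have hB := covOp_isPositive hφ hb ν
  obtain ⟨R, hR⟩ : ∃ R, R = Ring.inverse (covOp φ ν + l • 1) := ⟨_, rfl⟩
  obtain ⟨N, hN⟩ : ∃ N, N = effDim (covOp φ ν) l := ⟨_, rfl⟩
  have hn' : (0 : ℝ) < n := by exact_mod_cast hn
  have hNe : N = ∫ x, inner ℝ (φ x) (R (φ x)) ∂ν := by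
    rw [hN, hR, effDim_covOp hφ hb ν l]
  have h0 : ∀ x, 0 ≤ inner ℝ (φ x) (R (φ x)) := fun x => hR ▸ inner_inverse_nonneg hB hl _
  have hN0 : 0 ≤ N := hNe ▸ integral_nonneg h0
  have hone : ∀ x, l⁻¹ * ‖φ x‖ ≤ l⁻¹ := fun x =>
    mul_le_of_le_one_right (inv_nonneg.2 hl.le) (hb x)
  have h1 : ∀ x, inner ℝ (φ x) (R (φ x)) ≤ l⁻¹ := fun x => by
    rw [hR]
    refine (inner_inverse_le hB hl _).trans (mul_le_of_le_one_right (inv_nonneg.2 hl.le) ?_)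
    exact pow_le_one₀ (norm_nonneg _) (hb x)
  have h2 : ∀ x, ‖rankOneHS (basis H) (R (φ x)) (φ x)‖ ≤ ‖R (φ x)‖ :=
    norm_rankOneHS_le (basis H) hb R
  have h3 : ∀ x, ‖R (φ x)‖ ≤ l⁻¹ := fun x => by
    rw [hR]; exact (norm_inverse_le hB hl _).trans (hone x)
  have h4 : ∀ x, ‖R (φ x)‖ ^ 2 ≤ l⁻¹ * inner ℝ (φ x) (R (φ x)) := fun x => by
    rw [inv_mul_eq_div, le_div_iff₀' hl, hR]
    exact mul_norm_inverse_sq_le hB hl _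
  have hm1 : StronglyMeasurable fun x => inner ℝ (φ x) (R (φ x)) :=
    hφ.inner (R.continuous.comp_stronglyMeasurable hφ)
  have hm2 := stronglyMeasurable_rankOneHS (basis H) hφ R
  have hi1 : Integrable (fun x => l⁻¹ * inner ℝ (φ x) (R (φ x))) ν := by
    refine (Integrable.of_bound hm1.aestronglyMeasurable l⁻¹ (.of_forall fun x => ?_)).const_mul _
    rw [Real.norm_of_nonneg (h0 x)]
    exact h1 x
  -- Common second moment bound: both squared norms are at most `l⁻¹ ⟪φ, R φ⟫`, with integral `N /
  -- l`.
  have hσ : √(N / l) ^ 2 = ∫ x, l⁻¹ * inner ℝ (φ x) (R (φ x)) ∂ν := by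
    rw [Real.sq_sqrt (by positivity), integral_const_mul, ← hNe, inv_mul_eq_div]
  -- `η < 1` and `e < 4`.
  have hd : 1 ≤ Real.log (4 / η) := by
    rw [Real.le_log_iff_exp_le (by positivity), le_div_iff₀ hη0]
    nlinarith [Real.exp_one_lt_d9, Real.exp_pos 1]
  -- The `4` inside the logarithm makes each of the two tails exactly `η / 2`.
  have hexp : 2 * Real.exp (-Real.log (4 / η)) = η / 2 := by
    rw [Real.exp_neg, Real.exp_log (by positivity)]
    field_simp
    norm_num
  have hr : 2 * l⁻¹ / n + √(N / l) / √n = 2 / (l * n) + √(N / (n * l)) := by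
    rw [← Real.sqrt_div' _ hn'.le, div_div, mul_comm l]
    congr 1
    field_simp
  have hbern1 := measureReal_lt_norm_mean_sub_le (ν := ν) hm1 (L := l⁻¹) (σ := √(N / l))
    (by positivity) (by positivity)
    (fun x => by rw [Real.norm_of_nonneg (h0 x)]; exact h1 x) ?_ hn hd
  · have hbern2 := measureReal_lt_norm_mean_sub_le (ν := ν) hm2 (L := l⁻¹) (σ := √(N / l))
      (by positivity) (by positivity) (fun x => (h2 x).trans (h3 x)) ?_ hn hd
    · rw [hexp, hr] at hbern1 hbern2
      set r := 2 * Real.log (4 / η) * (2 / (l * n) + √(N / (n * l))) with hrd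
      have hunion := (measureReal_union_le (μ := Measure.pi fun _ : Fin n => ν) _ _).trans
        (add_le_add hbern1 hbern2)
      rw [add_halves] at hunion
      refine one_sub_le_measureReal_of_compl_subset hunion fun x hx => ?_
      · simp only [Set.compl_union, Set.mem_inter_iff, Set.mem_compl_iff, Set.mem_ofPred_eq,
          not_lt] at hx ⊢
        have := isProbabilityMeasure_empMeasure hn x
        have hdet := abs_effDim_covOp_sub_le hφ hb ν (empMeasure x) hl hR
        rw [integral_empMeasure x hm1, integral_empMeasure x hm2] at hdet
        refine hdet.trans ?_
        rw [← hN]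
        calc _ ≤ r + √(effDim (covOp φ (empMeasure x)) l) * r := by
              gcongr
              · exact hx.1
              · exact hx.2
          _ = _ := by rw [hrd]; ring
    · rw [hσ]
      exact integral_mono_of_nonneg (.of_forall fun x => sq_nonneg _) hi1 (.of_forall fun x =>
        (pow_le_pow_left₀ (norm_nonneg _) (h2 x) 2).trans (h4 x))
  · rw [hσ]
    refine integral_mono_of_nonneg (.of_forall fun x => sq_nonneg _) hi1 (.of_forall fun x => ?_)
    simp only [Real.norm_eq_abs, sq_abs]
    rw [sq]
    exact mul_le_mul_of_nonneg_right (h1 x) (h0 x)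

end Sample

/-! ### Kernel operators as covariance operators -/

section FeatureMap

variable {X : Type*} {H : Type*} [NormedAddCommGroup H] [InnerProductSpace ℝ H] [CompleteSpace H]
  [RKHS ℝ H X ℝ]

variable (H) in
/-- The normalised feature map `κ⁻¹ K (x, ·)`. -/
def featureBar (κ : ℝ) (x : X) : H := κ⁻¹ • feature H x

theorem rankOne_featureBar (κ : ℝ) (x : X) :
    InnerProductSpace.rankOne ℝ (featureBar H κ x) (featureBar H κ x) =
      (κ ^ 2)⁻¹ • pointOp H x := by
  ext f
  simp [featureBar, pointOp, smul_smul, sq]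

theorem norm_featureBar_le {κ : ℝ} (hκ : 0 < κ) (hκK : ∀ x : X, scalarKernel H x x ≤ κ ^ 2)
    (x : X) : ‖featureBar H κ x‖ ≤ 1 := by
  have h : ‖feature H x‖ ≤ κ :=
    le_of_sq_le_sq ((norm_feature_sq x).trans_le (hκK x)) hκ.le
  rw [featureBar, norm_smul, norm_inv, Real.norm_of_nonneg hκ.le]
  exact inv_mul_le_one_of_le₀ h hκ.le

variable [MeasurableSpace X]

theorem kernelOpBar_eq_covOp (ν : Measure X) (κ : ℝ) :
    kernelOpBar H ν κ = covOp (featureBar H κ) ν := by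
  simp_rw [kernelOpBar, kernelOp, covOp, rankOne_featureBar, integral_smul]

theorem stronglyMeasurable_featureBar [TopologicalSpace.SeparableSpace H]
    (hK : Measurable fun p : X × X => scalarKernel H p.1 p.2) (κ : ℝ) :
    StronglyMeasurable fun x : X => featureBar H κ x :=
  (stronglyMeasurable_feature hK).const_smul κ⁻¹

/-- Writing the sample average as an integral lets the results on covariance operators apply to the
empirical operator too. -/
theorem empKernelOpBar_eq_covOp [TopologicalSpace.SeparableSpace H]
    (hK : Measurable fun p : X × X => scalarKernel H p.1 p.2) (κ : ℝ) {n : ℕ} (x : Fin n → X) :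
    empKernelOpBar H x κ = covOp (featureBar H κ) (empMeasure x) := by
  have hc : Continuous fun f : H => InnerProductSpace.rankOne ℝ f f :=
    (InnerProductSpace.rankOne ℝ).continuous.clm_apply continuous_id
  rw [covOp, integral_empMeasure x
    (hc.comp_stronglyMeasurable (stronglyMeasurable_featureBar hK κ))]
  simp_rw [rankOne_featureBar, ← Finset.smul_sum, empKernelOpBar, empKernelOp]
  rw [smul_comm]

end FeatureMap

end EffDim

end

theorem mainTheorem5 {X : Type*} [MeasurableSpace X] [StandardBorelSpace X]
    (ν : MeasureTheory.Measure X) [MeasureTheory.IsProbabilityMeasure ν]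
    {H : Type*} [NormedAddCommGroup H] [InnerProductSpace ℝ H] [CompleteSpace H]
    [TopologicalSpace.SeparableSpace H] [RKHS ℝ H X ℝ]
    (hK : Measurable fun p : X × X => EffDim.scalarKernel H p.1 p.2)
    (κ : ℝ) (hκ : 0 < κ) (hκK : ∀ x : X, EffDim.scalarKernel H x x ≤ κ ^ 2)
    (η : ℝ) (hη0 : 0 < η) (hη1 : η < 1) (n : ℕ) (hn : 0 < n)
    (l : ℝ) (hl0 : 0 < l) (hl1 : l ≤ 1) :
    EffDim.EffDimDefined (EffDim.kernelOpBar H ν κ) l ∧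
    (∀ x : Fin n → X, EffDim.EffDimDefined (EffDim.empKernelOpBar H x κ) l) ∧
    1 - η ≤ (MeasureTheory.Measure.pi fun _ : Fin n => ν).real
      {x | |EffDim.effectiveDim H ν κ l - EffDim.empEffectiveDim H x κ l| ≤
        2 * Real.log (4 / η) * (1 + Real.sqrt (EffDim.empEffectiveDim H x κ l)) *
          (2 / (l * n) + Real.sqrt (EffDim.effectiveDim H ν κ l / (n * l)))} := by
  have hφ := EffDim.stronglyMeasurable_featureBar hK κ
  have hb := EffDim.norm_featureBar_le (H := H) hκ hκK
  simp only [EffDim.effectiveDim, EffDim.empEffectiveDim, EffDim.empKernelOpBar_eq_covOp hK,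
    EffDim.kernelOpBar_eq_covOp]
  refine ⟨EffDim.effDimDefined_covOp hφ hb ν hl0, fun x => ?_,
    EffDim.one_sub_le_measureReal_effDim_covOp hφ hb ν hη0 hη1 hn hl0⟩
  have := EffDim.isProbabilityMeasure_empMeasure hn x
  exact EffDim.effDimDefined_covOp hφ hb _ hl0
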